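/- Let $U$ and $n_t$ be positive integers. Call $(L/K,p,\sigma)$ suitable (for $U$ and $n_t$) if $K\subset\mathbb{C}$ is an imaginary quadratic field of class number $1$; $L\subset\mathbb{C}$ is a cyclic Galois extension of $K$ of degree $Un_t$ with $L=K(\alpha)$ for some $\alpha\in\mathbb{R}$; $\sigma$ is a generator of $\mathrm{Gal}(L/K)$; and $p\in\mathcal{O}_K$ is a prime element that is inert in $L/K$, i.e. $p\mathcal{O}_L$ is a prime ideal. For suitable $(L/K,p,\sigma)$ put $\tau=\sigma^U$, and for $x_1,\dots,x_{n_t}\in\mathcal{O}_L$ let $M(x_1,\dots,x_{n_t})$ be the $n_t\times n_t$ matrix whose entry in row $r$ and column $c$ ($1\le r,c\le n_t$) is $\tau^{c-1}(x_{r-c+1})$ if $c\le r$ and $p\,\tau^{c-1}(x_{n_t+r-c+1})$ if $c>r$. For an integer $m>\frac{U(n_t-1)}{2}$ let $C_{U,n_t}(L/K,p,\sigma,m)$ be the set of all $Un_t\times Un_t$ complex block matrices with $U\times U$ blocks of size $n_t\times n_t$ whose block in position $(j,k)$ is $\sigma^{k-1}(M_j)$ if $k\ne j$ and $p^{-m}\sigma^{j-1}(M_j)$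 if $k=j$, where $M_j=M(x_{j,1},\dots,x_{j,n_t})$ with $x_{j,1},\dots,x_{j,n_t}\in\mathcal{O}_L$ not all zero, for each $j=1,\dots,U$ (automorphisms act entrywise). Let $$\mathfrak{C}_{U,n_t}=\{\,C_{U,n_t}(L/K,p,\sigma,m) : (L/K,p,\sigma)\text{ suitable},\ m\in\mathbb{Z},\ m>\tfrac{U(n_t-1)}{2}\,\}.$$ Then $\mathfrak{C}_{U,n_t}\neq\emptyset$ for all positive integers $U$ and $n_t$; that is, suitable $L/K$, $p$, $\sigma$ and $m$ always exist. -/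

import Mathlib

open scoped NumberField

noncomputable section

namespace MACCode

/-- The data `K`, `L/K`, `p`, `σ` are suitable for `U` users with `n` transmit antennas each:
`K ⊆ ℂ` is an imaginary quadratic field of class number one, `L ⊆ ℂ` is a cyclic Galois extension
of `K` of degree `U * n` of the form `L = K(α)` with `α` real, `σ` generates `Gal(L/K)`, and `p` is
a prime element of the ring of integers of `K` which is inert in `L/K`. -/
structure IsSuitable (U n : ℕ) (K : Subfield ℂ) [NumberField K] (L : IntermediateField K ℂ)
    (p : 𝓞 K) (σ : L ≃ₐ[K] L) : Prop where
  quadratic : Module.finrank ℚ K = 2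
  imaginary : ∃ z ∈ K, z.im ≠ 0
  classNumber_eq_one : NumberField.classNumber K = 1
  galois : IsGalois K L
  degree : Module.finrank K L = U * n
  real_generator : ∃ α : ℝ, L = IntermediateField.adjoin K {(α : ℂ)}
  generator : ∀ g : L ≃ₐ[K] L, g ∈ Subgroup.zpowers σ
  prime : Prime p
  inert : ((Ideal.span {p}).map (algebraMap (𝓞 K) (𝓞 L))).IsPrime

variable {K : Subfield ℂ} {L : IntermediateField K ℂ}

/-- The matrix `M(x₁, …, xₙ)` of the left regular representation of
`x₁ + u x₂ + ⋯ + uⁿ⁻¹ xₙ` in the cyclic algebra `(L/F, τ, p)`, where `uⁿ = p`. With rows, columns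
and coefficients indexed from `0`, the entry at `(r, c)` is `τ^c (x (r - c))` on and below the
diagonal and `p * τ^c (x (n + r - c))` above it; the subtraction in `Fin n` is modulo `n`. -/
def regRep {n : ℕ} (p : 𝓞 K) (τ : L ≃ₐ[K] L) (x : Fin n → 𝓞 L) : Matrix (Fin n) (Fin n) L :=
  Matrix.of fun r c =>
    (if c ≤ r then 1 else algebraMap K L (p : K)) * (τ ^ (c : ℕ)) ((x (r - c) : 𝓞 L) : L)

/-- The `n × (U n)` matrix `B_j = (M, σ(M), …, p⁻ᵐ σʲ(M), …, σ^(U-1)(M))` of the `j`-th user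
(users are indexed from `0`), where `M = M(x₁, …, xₙ)` is formed with `τ = σ ^ U`. The column
index `(k, c)` stands for column `c` of the `k`-th block. -/
def userMatrix (U n : ℕ) (p : 𝓞 K) (σ : L ≃ₐ[K] L) (m : ℤ) (j : Fin U) (x : Fin n → 𝓞 L) :
    Matrix (Fin n) (Fin U × Fin n) ℂ :=
  Matrix.of fun r kc =>
    (if kc.1 = j then ((p : K) : ℂ) ^ (-m) else 1) *
      (((σ ^ (kc.1 : ℕ)) (regRep p (σ ^ U) x r kc.2) : L) : ℂ)

/-- The code of the `j`-th user: all matrices `B_j` with `(x₁, …, xₙ) ≠ 0`. -/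
def userCode (U n : ℕ) (p : 𝓞 K) (σ : L ≃ₐ[K] L) (m : ℤ) (j : Fin U) :
    Set (Matrix (Fin n) (Fin U × Fin n) ℂ) :=
  {B | ∃ x : Fin n → 𝓞 L, (∃ l, x l ≠ 0) ∧ B = userMatrix U n p σ m j x}

/-- The whole code `C_{U,n}(L/K, p, σ, m)`: all block matrices obtained by stacking
`B_1, …, B_U` with `B_j` in the code of the `j`-th user. The row index `(j, r)` stands for row `r`
of the `j`-th block. -/
def code (U n : ℕ) (p : 𝓞 K) (σ : L ≃ₐ[K] L) (m : ℤ) :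
    Set (Matrix (Fin U × Fin n) (Fin U × Fin n) ℂ) :=
  {A | ∀ j : Fin U, (Matrix.of fun r kc => A (j, r) kc) ∈ userCode U n p σ m j}

/-- The family of all codes `C_{U,n}(L/K, p, σ, m)` with suitable `L/K`, `p`, `σ` and a rational
integer `m > U (n - 1) / 2`. -/
def codeFamily (U n : ℕ) : Set (Set (Matrix (Fin U × Fin n) (Fin U × Fin n) ℂ)) :=
  {C | ∃ (K : Subfield ℂ) (_ : NumberField K) (L : IntermediateField K ℂ) (p : 𝓞 K)
      (σ : L ≃ₐ[K] L) (m : ℤ), IsSuitable U n K L p σ ∧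
        (U : ℚ) * ((n : ℚ) - 1) / 2 < (m : ℚ) ∧ C = code U n p σ m}

end MACCode

end

/-! Everything happens inside a cyclotomic field. Take K = ℚ(ζ₃), a prime q > 3 with q ≡ 1 mod Un,
and M = K(ζ_q) = ℚ(ζ_{3q}), which is cyclic over K of degree q - 1. Since Un divides q - 1, there is
an intermediate field L of degree Un over K.

For the inert prime, Dirichlet's theorem gives a rational prime l ≡ 1 mod 3 that is a primitive root
mod q. A prime P of M above l has norm l^(q-1), while its contraction to K has norm l; comparing
norms shows that the contraction stays prime in M (`exists_inert_prime`), hence also in L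
(`map_span_isPrime_of_tower`). It is principal because 𝓞 K is a PID.

L is abelian over ℚ, hence stable under complex conjugation, which yields a real generator
(`exists_real_generator`). The integer m need only be large. -/

theorem map_under_eq_of_absNorm_eq (K M : Type*) [Field K] [NumberField K] [Field M]
    [NumberField M] [Algebra K M] (P : Ideal (𝓞 M)) (h0 : P ≠ ⊥)
    (h : Ideal.absNorm P = Ideal.absNorm (P.under (𝓞 K)) ^ Module.finrank K M) :
    (P.under (𝓞 K)).map (algebraMap (𝓞 K) (𝓞 M)) = P := by
  obtain ⟨J, hJ⟩ := Ideal.dvd_iff_le.2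
    (Ideal.map_comap_le : (P.under (𝓞 K)).map (algebraMap (𝓞 K) (𝓞 M)) ≤ P)
  have h1 := Ideal.absNorm_algebraMap (𝓞 K) (S := 𝓞 M) (P.under (𝓞 K))
  have h2 : Module.finrank (𝓞 K) (𝓞 M) = Module.finrank K M :=
    (IsFractionRing.finrank_eq (𝓞 K) K (𝓞 M) M).symm
  rw [h2, ← h, hJ, map_mul] at h1
  have h4 : Ideal.absNorm J = 1 :=
    (Nat.mul_eq_left (Ideal.absNorm_eq_zero_iff.not.2 h0)).1 h1
  rw [hJ, Ideal.absNorm_eq_one_iff.1 h4, Ideal.mul_top]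

/-- The contraction of p𝓞_M to 𝓞_L is p𝓞_L: if p divides x ∈ 𝓞_L in 𝓞_M, the quotient x/p lies in L
and is integral. -/
theorem map_span_isPrime_of_tower (K L M : Type*) [Field K] [Field L] [Field M]
    [Algebra K L] [Algebra K M] [Algebra L M] [IsScalarTower K L M] [NumberField K]
    [NumberField L] [NumberField M] (p : 𝓞 K) (hp : p ≠ 0)
    (h : ((Ideal.span {p}).map (algebraMap (𝓞 K) (𝓞 M))).IsPrime) :
    ((Ideal.span {p}).map (algebraMap (𝓞 K) (𝓞 L))).IsPrime := by
  have : (Ideal.span {p}).map (algebraMap (𝓞 K) (𝓞 L)) =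
      ((Ideal.span {p}).map (algebraMap (𝓞 K) (𝓞 M))).comap (algebraMap (𝓞 L) (𝓞 M)) := by
    ext x
    simp only [Ideal.map_span, Set.image_singleton, Ideal.mem_span_singleton, Ideal.mem_comap]
    constructor
    · rintro ⟨y, rfl⟩
      rw [map_mul, ← IsScalarTower.algebraMap_apply]
      exact Dvd.intro _ rfl
    · rintro ⟨y, hy⟩
      have hpL : algebraMap K L p ≠ 0 := by simpa using hp
      have hy' : algebraMap L M (x / algebraMap K L p) = y := by
        have := congrArg (algebraMap (𝓞 M) M) hy
        rw [map_div₀, div_eq_iff (by simpa using hp)]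
        rw [map_mul] at this
        rw [mul_comm]
        refine this.trans (congrArg (· * _) ?_)
        exact IsScalarTower.algebraMap_apply K L M p
      have hint : IsIntegral ℤ (x / algebraMap K L p : L) := by
        rw [← isIntegral_algebraMap_iff (algebraMap L M).injective (A := L), hy']
        exact y.isIntegral_coe
      refine ⟨⟨_, hint⟩, NumberField.RingOfIntegers.coe_injective ?_⟩
      change (x : L) = algebraMap K L p * (x / algebraMap K L p)
      rw [mul_div_cancel₀ _ hpL]
  rw [this]
  exact Ideal.comap_isPrime _ _

theorem IntermediateField.exists_adjoin_simple_eq_of_le {F E : Type*} [Field F] [Field E]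
    [CharZero F] [Algebra F E] {R S : IntermediateField F E} [FiniteDimensional F S] (h : R ≤ S) :
    ∃ a : E, IntermediateField.adjoin F {a} = R := by
  have : FiniteDimensional F R :=
    .of_injective (IntermediateField.inclusion h).toLinearMap (IntermediateField.inclusion h).injective
  obtain ⟨a, ha⟩ := Field.exists_primitive_element F R
  refine ⟨a, ?_⟩
  rw [← IntermediateField.lift_adjoin_simple, ha, IntermediateField.lift_top]

/-- An intermediate field of `ℂ/K` that is normal over `ℚ`, where `K` is not real, is generated over
`K` by a real number: it is stable under conjugation, hence generated by its real elements. -/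
theorem exists_real_generator (K : Subfield ℂ) (L : IntermediateField K ℂ) [NumberField L]
    [hn : Normal ℚ L] (z : ℂ) (hz : z ∈ K) (hzi : z.im ≠ 0) :
    ∃ α : ℝ, L = IntermediateField.adjoin K {(α : ℂ)} := by
  let L' : IntermediateField ℚ ℂ := L.restrictScalars ℚ
  have hconj : ∀ x ∈ L, starRingEnd ℂ x ∈ L := by
    intro x hx
    have : @Normal ℚ L' _ _ L'.algebra' := by
      rw [Subsingleton.elim L'.algebra' DivisionRing.toRatAlgebra]
      exact hn
    have h := AlgHom.fieldRange_of_normal (E := L')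
      ((Complex.conjAe.toAlgHom.restrictScalars ℚ).comp L'.val)
    change _ ∈ L'
    rw [← h]
    exact ⟨⟨x, hx⟩, rfl⟩
  have hzL : z ∈ L := L.algebraMap_mem ⟨z, hz⟩
  let R : IntermediateField ℚ ℂ := L' ⊓ (Complex.ofRealAm.restrictScalars ℚ).fieldRange
  have : @FiniteDimensional ℚ L' _ _ L'.algebra'.toModule := by
    rw [Subsingleton.elim L'.algebra' DivisionRing.toRatAlgebra]
    exact inferInstanceAs (FiniteDimensional ℚ L)
  obtain ⟨a, ha⟩ := IntermediateField.exists_adjoin_simple_eq_of_le (R := R) (S := L') inf_le_left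
  obtain ⟨haL, α, hα⟩ : a ∈ R := ha ▸ IntermediateField.mem_adjoin_simple_self ℚ a
  replace hα : (α : ℂ) = a := hα
  subst hα
  refine ⟨α, le_antisymm ?_ ?_⟩
  · have hR : ∀ r : ℝ, (r : ℂ) ∈ L → (r : ℂ) ∈ IntermediateField.adjoin K {(α : ℂ)} := by
      intro r hr
      have h1 : (r : ℂ) ∈ R := ⟨hr, r, rfl⟩
      rw [← ha] at h1
      have h2 : IntermediateField.adjoin ℚ {(α : ℂ)} ≤
          (IntermediateField.adjoin K {(α : ℂ)}).restrictScalars ℚ :=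
        IntermediateField.adjoin_le_iff.2 (IntermediateField.subset_adjoin K {(α : ℂ)})
      exact h2 h1
    have hre : ∀ x ∈ L, (x.re : ℂ) ∈ L := fun x hx => by
      rw [Complex.re_eq_add_conj]
      exact L.div_mem (L.add_mem hx (hconj x hx)) (ofNat_mem L 2)
    have hI : ∀ x ∈ L, ((x.im / z.im : ℝ) : ℂ) ∈ L := fun x hx => by
      have h1 : ((x.im / z.im : ℝ) : ℂ) = (x - x.re) / (z - z.re) := by
        have h (w : ℂ) : w - w.re = w.im * Complex.I := by
          rw [sub_eq_iff_eq_add', Complex.re_add_im]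
        rw [h, h, mul_div_mul_right _ _ Complex.I_ne_zero, Complex.ofReal_div]
      rw [h1]
      exact L.div_mem (L.sub_mem hx (hre x hx)) (L.sub_mem hzL (hre z hzL))
    intro x hx
    -- The number z - re z, a real multiple of i, replaces i, which need not lie in L.
    have h1 : x = x.re + ((x.im / z.im : ℝ) : ℂ) * (z - z.re) := by
      apply Complex.ext <;> simp [hzi]
    rw [h1]
    exact add_mem (hR _ (hre x hx)) (mul_mem (hR _ (hI x hx))
      (sub_mem (IntermediateField.algebraMap_mem (IntermediateField.adjoin K {(α : ℂ)}) ⟨z, hz⟩)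
        (hR _ (hre z hzL))))
  · exact IntermediateField.adjoin_le_iff.2 (Set.singleton_subset_iff.2 haL)

theorem exists_intermediateField_finrank_eq (K M : Type*) [Field K] [Field M] [Algebra K M]
    [FiniteDimensional K M] [IsGalois K M] [IsCyclic (M ≃ₐ[K] M)] (N : ℕ)
    (hN : N ∣ Module.finrank K M) :
    ∃ F : IntermediateField K M, Module.finrank K F = N := by
  obtain ⟨g, hg⟩ := IsCyclic.exists_ofOrder_eq_natCard (α := M ≃ₐ[K] M)
  rw [IsGalois.card_aut_eq_finrank] at hg
  have hpos : 0 < Module.finrank K M := Module.finrank_pos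
  have hN0 : N ≠ 0 := by rintro rfl; rw [zero_dvd_iff] at hN; omega
  -- For a generator g, the subgroup generated by g ^ N has index N.
  refine ⟨IntermediateField.fixedField (Subgroup.zpowers (g ^ N)), ?_⟩
  have h1 := IntermediateField.finrank_fixedField_eq_card (Subgroup.zpowers (g ^ N))
  rw [Nat.card_zpowers, orderOf_pow_of_dvd hN0 (hg ▸ hN), hg] at h1
  have h2 := Module.finrank_mul_finrank K (IntermediateField.fixedField (Subgroup.zpowers (g ^ N))) M
  rw [h1] at h2
  obtain ⟨d, hd⟩ := hN
  rw [hd, Nat.mul_div_cancel_left d (Nat.pos_of_ne_zero hN0)] at h2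
  have hd0 : 0 < d := by
    rcases Nat.eq_zero_or_pos d with rfl | h
    · omega
    · exact h
  exact Nat.eq_of_mul_eq_mul_right hd0 h2

/-- A prime `l ≡ 1 mod 3` that is a primitive root modulo `q`. -/
theorem exists_prime_orderOf_eq (q : ℕ) (hq : q.Prime) (h3 : 3 < q) :
    ∃ l : ℕ, l.Prime ∧ ¬ l ∣ 3 * q ∧ l ≡ 1 [MOD 3] ∧ orderOf (l : ZMod (3 * q)) = q - 1 := by
  have : Fact q.Prime := ⟨hq⟩
  have hco : Nat.Coprime 3 q := (Nat.coprime_primes Nat.prime_three hq).2 h3.ne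
  obtain ⟨g, hg⟩ := IsCyclic.exists_ofOrder_eq_natCard (α := (ZMod q)ˣ)
  rw [Nat.card_eq_fintype_card, ZMod.card_units] at hg
  obtain ⟨a, ha3, haq⟩ := Nat.chineseRemainder hco 1 (g : ZMod q).val
  have hac : a.Coprime (3 * q) := by
    refine Nat.Coprime.mul_right ?_ ?_
    · rw [Nat.Coprime, ha3.gcd_eq]; simp
    · rw [Nat.Coprime, haq.gcd_eq]; exact ZMod.val_coe_unit_coprime g
  -- Dirichlet's theorem; the bound l > 3q ensures that l does not divide 3q.
  obtain ⟨l, hlgt, hl, hla⟩ := Nat.forall_exists_prime_gt_and_modEq (3 * q) (by omega) hac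
  have hl3 : l ≡ 1 [MOD 3] := (hla.of_mul_right q).trans ha3
  have hlq : (l : ZMod q) = g := by
    rw [(ZMod.natCast_eq_natCast_iff _ _ _).2 ((hla.of_mul_left 3).trans haq)]
    exact ZMod.natCast_zmod_val _
  have hl3' : (l : ZMod 3) = 1 := by
    simpa using (ZMod.natCast_eq_natCast_iff _ _ _).2 hl3
  refine ⟨l, hl, fun h => ?_, hl3, ?_⟩
  · exact absurd (Nat.le_of_dvd (by omega) h) (by omega)
  · rw [← orderOf_injective (ZMod.chineseRemainder hco).toMonoidHom
      (ZMod.chineseRemainder hco).injective]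
    have : (ZMod.chineseRemainder hco).toMonoidHom (l : ZMod (3 * q)) =
        ((1, g) : ZMod 3 × ZMod q) := by
      change ZMod.chineseRemainder hco (l : ZMod (3 * q)) = _
      rw [map_natCast]
      exact Prod.ext (by simpa using hl3') (by simpa using hlq)
    rw [this, Prod.orderOf]
    simp [orderOf_units, hg]

theorem IsCyclotomicExtension.Rat.absNorm_of_liesOver (m : ℕ) [NeZero m] (M : Type*) [Field M]
    [NumberField M] [IsCyclotomicExtension {m} ℚ M] (l : ℕ) (hl : l.Prime) (hm : ¬ l ∣ m)
    (P : Ideal (𝓞 M)) [P.IsPrime] [P.LiesOver (Ideal.span {(l : ℤ)})] :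
    Ideal.absNorm P = l ^ orderOf (l : ZMod m) := by
  have : Fact l.Prime := ⟨hl⟩
  rw [← IsCyclotomicExtension.Rat.inertiaDeg_eq_of_not_dvd l M P hm]
  exact (Ideal.pow_inertiaDeg l P).symm

theorem IsCyclotomicExtension.trans_of_coprime (m n : ℕ) [NeZero m] [NeZero n] (h : m.Coprime n)
    (A B C : Type*) [Field A] [Field B] [Field C] [Algebra A B] [Algebra A C] [Algebra B C]
    [IsScalarTower A B C] [hm : IsCyclotomicExtension {m} A B] [hn : IsCyclotomicExtension {n} B C] :
    IsCyclotomicExtension {m * n} A C := by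
  have := IsCyclotomicExtension.trans {m} {n} A B C (algebraMap B C).injective
  obtain ⟨x, hx⟩ := hm.exists_isPrimitiveRoot rfl (NeZero.ne m)
  obtain ⟨y, hy⟩ := hn.exists_isPrimitiveRoot rfl (NeZero.ne n)
  have hxy := (hx.map_of_injective (algebraMap B C).injective).pow_mul_pow_lcm hy
    (NeZero.ne m) (NeZero.ne n)
  rw [h.lcm_eq_mul] at hxy
  have := IsCyclotomicExtension.union_of_isPrimitiveRoot ({m} ∪ {n}) A C hxy
  have hmn : m * n ≠ 0 := NeZero.ne _
  rw [IsCyclotomicExtension.iff_union_of_dvd (S := {m * n}) (n := m) A C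
    ⟨_, rfl, hmn, Dvd.intro _ rfl⟩, IsCyclotomicExtension.iff_union_of_dvd (n := n) A C
    ⟨_, Or.inl rfl, hmn, Dvd.intro_left _ rfl⟩, Set.union_assoc, Set.union_comm]
  exact this

theorem exists_subfield_isCyclotomicExtension_three :
    ∃ K : Subfield ℂ, IsCyclotomicExtension {3} ℚ K := by
  have h := IntermediateField.isCyclotomicExtension_adjoin_of_exists_isPrimitiveRoot {3} ℚ ℂ
    fun n _ hn => ⟨_, Complex.isPrimitiveRoot_exp n hn⟩
  refine ⟨(IntermediateField.adjoin ℚ {b : ℂ | ∃ n ∈ ({3} : Set ℕ), n ≠ 0 ∧ b ^ n = 1}).toSubfield,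
    ?_⟩
  rw [Subsingleton.elim DivisionRing.toRatAlgebra (IntermediateField.algebra' _)]
  exact h

theorem exists_mem_im_ne_zero_of_isCyclotomicExtension_three (K : Subfield ℂ) [h : IsCyclotomicExtension {3} ℚ K] :
    ∃ z ∈ K, z.im ≠ 0 := by
  obtain ⟨z, hz⟩ := h.exists_isPrimitiveRoot rfl (by norm_num)
  refine ⟨z, z.2, fun him => ?_⟩
  have hz' : IsPrimitiveRoot (z : ℂ) 3 := hz.map_of_injective K.subtype.injective
  have hr : ((z : ℂ).re : ℂ) = z := Complex.ext rfl him.symm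
  have h1 : (z : ℂ).re ^ 3 = 1 := by
    have := hz'.pow_eq_one
    rw [← hr] at this
    exact_mod_cast this
  have h2 : (z : ℂ).re = 1 := by
    rwa [pow_eq_one_iff_of_ne_zero (by norm_num), or_iff_left (by simp [Nat.even_iff])] at h1
  rw [h2] at hr
  exact hz'.ne_one (by norm_num) (by simpa using hr.symm)

/-- The action on a primitive q-th root of unity embeds the Galois group in the cyclic group (ℤ/q)ˣ.
-/
theorem IsCyclotomicExtension.isCyclic_algEquiv_of_prime (q : ℕ) [Fact q.Prime] (K M : Type*) [Field K] [Field M] [Algebra K M]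
    [IsCyclotomicExtension {q} K M] : IsCyclic (M ≃ₐ[K] M) := by
  obtain ⟨z, hz⟩ := IsCyclotomicExtension.exists_isPrimitiveRoot K M (S := {q}) rfl (NeZero.ne q)
  exact isCyclic_of_injective (hz.autToPow K) (hz.autToPow_injective K)

theorem exists_inert_prime (q : ℕ) (hq : q.Prime) (h3 : 3 < q) (K M : Type*) [Field K]
    [NumberField K] [Field M] [NumberField M] [Algebra K M] [IsCyclotomicExtension {3} ℚ K]
    [IsCyclotomicExtension {3 * q} ℚ M] (hdeg : Module.finrank K M = q - 1) :
    ∃ p : 𝓞 K, Prime p ∧ ((Ideal.span {p}).map (algebraMap (𝓞 K) (𝓞 M))).IsPrime := by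
  obtain ⟨l, hl, hlq, hl3, hord⟩ := exists_prime_orderOf_eq q hq h3
  have : NeZero (3 * q) := ⟨by omega⟩
  have hl0 : Prime (l : ℤ) := Nat.prime_iff_prime_int.mp hl
  have hlp : (Ideal.span {(l : ℤ)}).IsPrime := (Ideal.span_singleton_prime hl0.ne_zero).2 hl0
  obtain ⟨⟨P, hP, hPl⟩⟩ := (Ideal.span {(l : ℤ)}).nonempty_primesOver (S := 𝓞 M)
  have hPK : (P.under (𝓞 K)).LiesOver (Ideal.span {(l : ℤ)}) := inferInstance
  have hM := IsCyclotomicExtension.Rat.absNorm_of_liesOver (3 * q) M l hl hlq P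
  have hK := IsCyclotomicExtension.Rat.absNorm_of_liesOver 3 K l hl
    (fun h => hlq (h.mul_right q)) (P.under (𝓞 K))
  have hl1 : (l : ZMod 3) = 1 := by simpa using (ZMod.natCast_eq_natCast_iff _ _ _).2 hl3
  rw [hl1, orderOf_one, pow_one] at hK
  have hP0 : P ≠ ⊥ := by
    rintro rfl
    rw [Ideal.absNorm_bot] at hM
    exact pow_ne_zero _ hl.ne_zero hM.symm
  have hPK0 : P.under (𝓞 K) ≠ ⊥ := by
    intro h
    rw [h, Ideal.absNorm_bot] at hK
    exact hl.ne_zero hK.symm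
  have := IsCyclotomicExtension.Rat.three_pid K
  obtain ⟨p, hp⟩ := IsPrincipalIdealRing.principal (P.under (𝓞 K))
  rw [Ideal.submodule_span_eq] at hp
  have hp0 : p ≠ 0 := by
    rintro rfl
    exact hPK0 (by simpa using hp)
  refine ⟨p, (Ideal.span_singleton_prime hp0).1 (hp ▸ inferInstance), ?_⟩
  rw [← hp, map_under_eq_of_absNorm_eq K M P hP0 (by rw [hM, hK, hdeg, hord])]
  exact hP

theorem mainTheorem8 (U n : ℕ) (hU : 0 < U) (hn : 0 < n) :
    MACCode.codeFamily U n ≠ ∅ := by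
  obtain ⟨q, hq, h3, hq1⟩ := Nat.exists_prime_gt_modEq_one (k := U * n) 3 (by positivity)
  have : Fact q.Prime := ⟨hq⟩
  obtain ⟨K, hK⟩ := exists_subfield_isCyclotomicExtension_three
  have : NumberField K := IsCyclotomicExtension.numberField {3} ℚ K
  have hKd : Module.finrank ℚ K = 2 :=
    IsCyclotomicExtension.finrank K (Polynomial.cyclotomic.irreducible_rat (by norm_num : 0 < 3))
  obtain ⟨z, hz, hzi⟩ := exists_mem_im_ne_zero_of_isCyclotomicExtension_three K
  let M := IntermediateField.adjoin K {b : ℂ | ∃ n ∈ ({q} : Set ℕ), n ≠ 0 ∧ b ^ n = 1}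
  have hM : IsCyclotomicExtension {q} K M :=
    IntermediateField.isCyclotomicExtension_adjoin_of_exists_isPrimitiveRoot {q} K ℂ
      fun n _ hn => ⟨_, Complex.isPrimitiveRoot_exp n hn⟩
  have : NumberField M := IsCyclotomicExtension.numberField {q} K M
  have hco : Nat.Coprime 3 q := (Nat.coprime_primes Nat.prime_three hq).2 h3.ne
  have hMQ : IsCyclotomicExtension {3 * q} ℚ M :=
    IsCyclotomicExtension.trans_of_coprime 3 q hco ℚ K M
  have hMd : Module.finrank ℚ M = 2 * (q - 1) := by
    rw [IsCyclotomicExtension.finrank M (Polynomial.cyclotomic.irreducible_rat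
      (by omega : 0 < 3 * q)), Nat.totient_mul hco, Nat.totient_prime hq]
    rfl
  have hKM : Module.finrank K M = q - 1 := by
    rw [← Module.finrank_mul_finrank ℚ K M, hKd] at hMd
    omega
  obtain ⟨p, hp, hpM⟩ := exists_inert_prime q hq h3 K M hKM
  have : IsGalois K M := IsCyclotomicExtension.isGalois {q} K M
  have := IsCyclotomicExtension.isCyclic_algEquiv_of_prime q K M
  obtain ⟨F, hF⟩ := exists_intermediateField_finrank_eq K M (U * n)
    (by rw [hKM]; exact (Nat.modEq_iff_dvd' (by omega)).1 hq1.symm)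
  have : IsAbelianGalois K M := IsCyclotomicExtension.isAbelianGalois {q} K M
  have : IsAbelianGalois ℚ M := IsCyclotomicExtension.isAbelianGalois {3 * q} ℚ M
  have : NumberField F := inferInstance
  -- F is a subfield of M; its lift L is the same field viewed inside ℂ.
  let e := IntermediateField.liftAlgEquiv F
  let L := IntermediateField.lift F
  have hLn : NumberField L := .of_ringEquiv _ _ e.toRingEquiv
  let f : L →ₐ[K] M := F.val.comp e.symm.toAlgHom
  have : IsAbelianGalois K L := .of_algHom f
  have : IsAbelianGalois ℚ L := .of_algHom (f.restrictScalars ℚ)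
  have hcyc : IsCyclic (L ≃ₐ[K] L) := by
    let : Algebra L M := f.toRingHom.toAlgebra
    have : IsScalarTower K L M := .of_algebraMap_eq' f.comp_algebraMap.symm
    exact isCyclic_of_surjective (AlgEquiv.restrictNormalHom (F := K) (K₁ := M) L)
      (AlgEquiv.restrictNormalHom_surjective M)
  obtain ⟨σ, hσ⟩ := hcyc.exists_generator
  have hpL : ((Ideal.span {p}).map (algebraMap (𝓞 K) (𝓞 L))).IsPrime := by
    let : Algebra L M := f.toRingHom.toAlgebra
    have : IsScalarTower K L M := .of_algebraMap_eq' f.comp_algebraMap.symm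
    exact map_span_isPrime_of_tower K L M p hp.ne_zero hpM
  obtain ⟨m, hm⟩ := exists_int_gt ((U : ℚ) * ((n : ℚ) - 1) / 2)
  refine Set.nonempty_iff_ne_empty.1 ⟨_, K, inferInstance, L, p, σ, m, ?_, hm, rfl⟩
  exact
    { quadratic := hKd
      imaginary := ⟨z, hz, hzi⟩
      classNumber_eq_one := NumberField.classNumber_eq_one_iff.2
        (IsCyclotomicExtension.Rat.three_pid K)
      galois := inferInstance
      degree := e.toLinearEquiv.finrank_eq.symm.trans hF
      real_generator := exists_real_generator K L z hz hzi
      generator := hσ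
      prime := hp
      inert := hpL }
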